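/- There is an absolute constant $C>0$ such that the following holds for every real $\gamma\ge 2/3$ and every natural number $n$. Let $U_1,\dots,U_n$, $V_1,\dots,V_n$ and $W_{ij}$ ($1\le i,j\le n$) be real random variables on a common probability space, all jointly independent and each uniformly distributed on $[0,1]$. Consider the random bipartite graph with parts $\{A_1,\dots,A_n\}$ and $\{B_1,\dots,B_n\}$ in which $A_i$ and $B_j$ are joined by an edge if and only if $U_i\le W_{ij}\le V_j$. Then, with probability at least $1-5\exp(-2n^{2\gamma-1})$, this graph has a matching that covers all but at most $C n^{\gamma}$ of its $2n$ vertices. -/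

import Mathlib

/-- The bipartite graph on the vertices `A_1, …, A_n` (the left summand) and `B_1, …, B_n`
(the right summand), where `A_i` is labelled by `u i` and `B_j` by `v j`:
there is an edge between `A_i` and `B_j` if and only if `u i ≤ w i j ≤ v j`. -/
def labelGraph {n : ℕ} (u v : Fin n → ℝ) (w : Fin n → Fin n → ℝ) :
    SimpleGraph (Fin n ⊕ Fin n) where
  Adj
    | .inl i, .inr j => u i ≤ w i j ∧ w i j ≤ v j
    | .inr j, .inl i => u i ≤ w i j ∧ w i j ≤ v j
    | .inl _, .inl _ => False
    | .inr _, .inr _ => False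
  symm := ⟨by rintro (i | i) (j | j) h <;> exact h⟩
  loopless := ⟨by rintro (i | i) h <;> exact h⟩

/-- `G` has a matching covering all but at most `m` of its vertices. -/
def HasMatchingOfAllBut {V : Type*} [Fintype V] (G : SimpleGraph V) (m : ℝ) : Prop :=
  ∃ M : G.Subgraph, M.IsMatching ∧ ((M.vertsᶜ : Set V).ncard : ℝ) ≤ m

/-!
The proof works at the scale `N = ⌈n ^ γ⌉`. By Hall's theorem with deficiency
(`hasMatchingOfAllBut_labelGraph`), it is enough that any sets `S` of `A`-vertices and `T` of
`B`-vertices with `#S + #T > n + 11 N` span an edge. Two properties together ensure this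
(`exists_edge_of_evenly_spread`).

* The labels are evenly spread: for each grid point `k / n`, fewer than `n - k + 2 N` of the `U i`
  exceed it and fewer than `k + 2 N` of the `V j` lie below it. By Hoeffding's inequality and a
  union bound over the grid, this fails with probability at most `2 (n + 1) exp (-8 N² / n)`.
* The `W i j` have no large empty rectangle: for all `k ≤ n - 2 N` and `S`, `T` of size at least
  `2 N`, some `W i j` with `i ∈ S`, `j ∈ T` lies in `[k / n, (k + 2 N) / n]`. For fixed `k`, `S`, `T` this
  fails with probability at most `(1 - 2 N / n) ^ (4 N²) ≤ exp (-8 N³ / n)`, and there are at most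
  `(n + 1) 4 ^ n` triples.

Given such large `S` and `T`, even spread yields a `k` for which at least `2 N` members of `S` have
label at most `k / n` and at least `2 N` members of `T` have label at least `(k + 2 N) / n`; the
second property, applied to these members, then gives an edge. Since the second property involves
the `W i j` alone, no conditioning on the labels is needed.

The exponent `2 / 3` is what makes `N³ / n ≥ n`, so that the factor `4 ^ n` is absorbed; the
factor `n + 1` is at most `exp (3 n ^ (2 γ - 1))` because `2 γ - 1 ≥ 1 / 3`. The two label events
and the rectangle event then each have probability at most `exp (-2 n ^ (2 γ - 1))`, and the
matching misses at most `22 N ≤ 44 n ^ γ` vertices.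
-/

section

open Finset MeasureTheory ProbabilityTheory

/-! ### Matchings from Hall's theorem with deficiency -/

/-- **Hall's theorem with deficiency**: if Hall's condition fails by at most `d` on every set, then
all but `d` of the indices have a system of distinct representatives. -/
theorem exists_injective_of_card_le_card_biUnion_add {ι α : Type*} [Fintype ι]
    [DecidableEq α] (t : ι → Finset α) (d : ℕ) (h : ∀ S : Finset ι, #S ≤ #(S.biUnion t) + d) :
    ∃ (D : Finset ι) (f : D → α), Fintype.card ι ≤ #D + d ∧ Function.Injective f ∧
      ∀ i : D, f i ∈ t i := by
  classical
  -- Add to every `t i` the same `d` new elements and apply Hall's theorem.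
  obtain ⟨g, hg, hgt⟩ := (Finset.all_card_le_biUnion_card_iff_exists_injective
    (fun i => (t i).disjSum (univ : Finset (Fin d)))).1 fun S => by
      rcases S.eq_empty_or_nonempty with rfl | ⟨i₀, hi₀⟩
      · simp
      · have hsub : (S.biUnion t).disjSum (univ : Finset (Fin d)) ⊆
            S.biUnion fun i => (t i).disjSum (univ : Finset (Fin d)) := by
          rintro (a | b) hx
          · simpa using hx
          · simpa using ⟨i₀, hi₀⟩
        calc #S ≤ #(S.biUnion t) + d := h S
          _ = #((S.biUnion t).disjSum (univ : Finset (Fin d))) := by simp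
          _ ≤ _ := card_le_card hsub
  have hD : ∀ i : ({i | (g i).isLeft} : Finset ι), (g i).isLeft := fun i =>
    (mem_filter.1 i.2).2
  refine ⟨({i | (g i).isLeft} : Finset ι), fun i => (g i).getLeft (hD i), ?_, ?_, ?_⟩
  · have hcompl : #({i | ¬ (g i).isLeft} : Finset ι) ≤ d := by
      calc _ ≤ #((univ : Finset (Fin d)).map ⟨Sum.inr (α := α), Sum.inr_injective⟩) := by
            refine card_le_card_of_injOn g ?_ hg.injOn
            intro i hi
            have hi' : (g i).isLeft = false := by simpa using hi
            cases hgi : g i with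
            | inl a => simp [hgi] at hi'
            | inr b => simp
        _ = d := by simp
    have := card_filter_add_card_filter_not (s := (univ : Finset ι)) (fun i => (g i).isLeft = true)
    rw [card_univ] at this
    omega
  · intro i j hij
    apply Subtype.ext
    apply hg
    rw [← Sum.inl_getLeft (g i) (hD i), ← Sum.inl_getLeft (g j) (hD j)]
    exact congrArg _ hij
  · intro i
    have := hgt i
    rw [← Sum.inl_getLeft (g i) (hD i), inl_mem_disjSum] at this
    exact this

theorem HasMatchingOfAllBut.mono {V : Type*} [Fintype V] {G : SimpleGraph V} {m m' : ℝ}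
    (hG : HasMatchingOfAllBut G m) (h : m ≤ m') : HasMatchingOfAllBut G m' :=
  let ⟨M, hM, hm⟩ := hG
  ⟨M, hM, hm.trans h⟩

/-- If any two vertex sets of total size more than `n + d`, one in each part, span an edge, then
some matching misses at most `d` vertices of each part. -/
theorem hasMatchingOfAllBut_labelGraph {n : ℕ} (u v : Fin n → ℝ) (w : Fin n → Fin n → ℝ) (d : ℕ)
    (h : ∀ S T : Finset (Fin n), n + d < #S + #T →
      ∃ i ∈ S, ∃ j ∈ T, u i ≤ w i j ∧ w i j ≤ v j) :
    HasMatchingOfAllBut (labelGraph u v w) (2 * d) := by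
  classical
  obtain ⟨D, f, hD, hf, hft⟩ := exists_injective_of_card_le_card_biUnion_add
    (fun i : Fin n => ({j | u i ≤ w i j ∧ w i j ≤ v j} : Finset (Fin n))) d fun S => by
      -- A violating `S` and the complement of its neighbourhood would span no edge.
      by_contra! hS
      obtain ⟨i, hi, j, hj, hij⟩ := h S (S.biUnion fun i => {j | u i ≤ w i j ∧ w i j ≤ v j})ᶜ (by
        rw [card_compl, Fintype.card_fin]
        omega)
      simp only [mem_compl, mem_biUnion, mem_filter, mem_univ, true_and, not_exists, not_and] at hj
      exact hj i hi hij.1 hij.2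
  have hinl : Function.Injective (fun i : D => (Sum.inl i.1 : Fin n ⊕ Fin n)) :=
    Sum.inl_injective.comp Subtype.val_injective
  have hinr : Function.Injective (fun i : D => (Sum.inr (f i) : Fin n ⊕ Fin n)) :=
    Sum.inr_injective.comp hf
  obtain ⟨M, hMv, hM⟩ := SimpleGraph.Subgraph.IsMatching.exists_of_disjoint_sets_of_equiv
    (G := labelGraph u v w) (s := Set.range fun i : D => (Sum.inl i.1 : Fin n ⊕ Fin n))
    (t := Set.range fun i : D => (Sum.inr (f i) : Fin n ⊕ Fin n))
    (by rw [Set.disjoint_left]; rintro _ ⟨i, rfl⟩ ⟨j, hj⟩; cases hj)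
    ((Equiv.ofInjective _ hinl).symm.trans (Equiv.ofInjective _ hinr)) (by
      rintro ⟨_, i, rfl⟩
      have : (Equiv.ofInjective _ hinl).symm ⟨_, i, rfl⟩ = i :=
        Equiv.ofInjective_symm_apply hinl i
      rw [Equiv.trans_apply, this]
      simpa [labelGraph] using hft i)
  refine ⟨M, hM, ?_⟩
  have hcard : M.verts.ncard = #D + #D := by
    rw [hMv, Set.ncard_union_eq
      (by rw [Set.disjoint_left]; rintro _ ⟨i, rfl⟩ ⟨j, hj⟩; cases hj),
      ← Set.image_univ, ← Set.image_univ, Set.ncard_image_of_injective _ hinl,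
      Set.ncard_image_of_injective _ hinr]
    simp
  have hcompl := Set.ncard_add_ncard_compl M.verts
  rw [hcard, Nat.card_eq_fintype_card, Fintype.card_sum, Fintype.card_fin] at hcompl
  rw [Fintype.card_fin] at hD
  have : (M.vertsᶜ : Set (Fin n ⊕ Fin n)).ncard ≤ 2 * d := by omega
  exact_mod_cast this

/-- Evenly spread labels `u`, `v` and the absence of large empty rectangles in `w` force an edge
between any two large vertex sets. -/
theorem exists_edge_of_evenly_spread {n : ℕ} (N : ℕ) (hN : 0 < N) (u v : Fin n → ℝ)
    (w : Fin n → Fin n → ℝ)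
    (hu : ∀ k ≤ n, #{i | (k / n : ℝ) < u i} + k < n + 2 * N)
    (hv : ∀ k ≤ n, #{j | v j < (k / n : ℝ)} < k + 2 * N)
    (hw : ∀ k, k + 2 * N ≤ n → ∀ S T : Finset (Fin n), 2 * N ≤ #S → 2 * N ≤ #T →
      ∃ i ∈ S, ∃ j ∈ T, w i j ∈ Set.Icc (k / n : ℝ) ((k + 2 * N : ℕ) / n : ℝ))
    (S T : Finset (Fin n)) (hST : n + 11 * N < #S + #T) :
    ∃ i ∈ S, ∃ j ∈ T, u i ≤ w i j ∧ w i j ≤ v j := by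
  classical
  have hS : #S ≤ n := by simpa using card_le_univ S
  have hT : #T ≤ n := by simpa using card_le_univ T
  have hSu : ∀ k : ℕ, #S ≤ #{i ∈ S | u i ≤ (k / n : ℝ)} + #{i | (k / n : ℝ) < u i} := fun k => by
    rw [← card_filter_add_card_filter_not (s := S) (fun i => u i ≤ (k / n : ℝ))]
    refine Nat.add_le_add_left (card_le_card fun i hi => ?_) _
    simpa using (mem_filter.1 hi).2
  have hTv : ∀ k : ℕ, #T ≤ #{j ∈ T | (k / n : ℝ) ≤ v j} + #{j | v j < (k / n : ℝ)} := fun k => by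
    rw [← card_filter_add_card_filter_not (s := T) (fun j => (k / n : ℝ) ≤ v j)]
    refine Nat.add_le_add_left (card_le_card fun i hi => ?_) _
    simpa using (mem_filter.1 hi).2
  -- Take the least `k` such that `2 N` labels of `S` are at most `k / n`. Minimality says that most
  -- of `S` has labels above `(k - 1) / n`, which bounds `#S`, so that `T` has to be large.
  have hex : ∃ k : ℕ, 2 * N ≤ #{i ∈ S | u i ≤ (k / n : ℝ)} := ⟨n - (2 * N + 1), by
    have h1 := hSu (n - (2 * N + 1))
    have h2 := hu (n - (2 * N + 1)) (by omega)
    omega⟩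
  obtain ⟨k, hk, hmin⟩ : ∃ k : ℕ, 2 * N ≤ #{i ∈ S | u i ≤ (k / n : ℝ)} ∧
      ∀ l < k, #{i ∈ S | u i ≤ (l / n : ℝ)} < 2 * N :=
    ⟨Nat.find hex, Nat.find_spec hex, fun l hl => not_le.1 (Nat.find_min hex hl)⟩
  have hkn : k + 2 * N < n := by
    by_contra! hcon
    have h1 := hSu (n - (2 * N + 1))
    have h2 := hu (n - (2 * N + 1)) (by omega)
    have h3 := hmin (n - (2 * N + 1)) (by omega)
    omega
  have hTk : 2 * N ≤ #{j ∈ T | ((k + 2 * N : ℕ) / n : ℝ) ≤ v j} := by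
    have h1 := hTv (k + 2 * N)
    have h2 := hv (k + 2 * N) hkn.le
    -- For `k = 0` minimality says nothing, but then `#S ≤ n` suffices.
    rcases Nat.eq_zero_or_pos k with rfl | hpos
    · omega
    · have h3 := hmin (k - 1) (by omega)
      have h4 := hSu (k - 1)
      have h5 := hu (k - 1) (by omega)
      omega
  obtain ⟨i, hi, j, hj, hij⟩ := hw k hkn.le _ _ hk hTk
  rw [mem_filter] at hi hj
  exact ⟨i, hi.1, j, hj.1, hi.2.trans hij.1, hij.2.trans hj.2⟩

/-! ### Independent uniform variables -/

section
variable {Ω : Type*} [MeasurableSpace Ω] {μ : Measure Ω}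

theorem measureReal_preimage_of_isUniform {X : Ω → ℝ} (hX : pdf.IsUniform X (Set.Icc 0 1) μ)
    {A : Set ℝ} (hA : MeasurableSet A) :
    μ.real (X ⁻¹' A) = volume.real (Set.Icc 0 1 ∩ A) := by
  rw [measureReal_def, hX.measure_preimage (by simp) (by simp) hA]
  simp [measureReal_def]

theorem aemeasurable_of_isUniform {X : Ω → ℝ} (hX : pdf.IsUniform X (Set.Icc 0 1) μ) :
    AEMeasurable X μ :=
  hX.aemeasurable (by simp) (by simp)

/-- **Hoeffding's inequality** for the number of independent variables that fall into `A`, each with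
probability `p`. -/
theorem measureReal_card_filter_mem_ge_le [IsProbabilityMeasure μ] {n : ℕ} {X : Fin n → Ω → ℝ}
    (hX : ∀ i, AEMeasurable (X i) μ)
    (hind : iIndepFun X μ) {A : Set ℝ} (hA : MeasurableSet A) [DecidablePred (· ∈ A)]
    {p δ : ℝ} (hp : ∀ i, μ.real (X i ⁻¹' A) = p) (hδ : 0 ≤ δ) :
    μ.real {ω | n * p + δ ≤ #{i | X i ω ∈ A}} ≤ Real.exp (-(2 * δ ^ 2 / n)) := by
  have hmeas : Measurable (A.indicator (1 : ℝ → ℝ)) := measurable_one.indicator hA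
  have hsub : ∀ i ∈ (univ : Finset (Fin n)),
      HasSubgaussianMGF (fun ω => A.indicator 1 (X i ω) - p) ((‖(1 : ℝ) - 0‖₊ / 2) ^ 2) μ := by
    intro i _
    have hint : ∫ ω, A.indicator (1 : ℝ → ℝ) (X i ω) ∂μ = p := by
      rw [← integral_map (hX i) hmeas.aestronglyMeasurable, integral_indicator_one hA,
        map_measureReal_apply_of_aemeasurable (hX i) hA, hp]
    rw [← hint]
    refine hasSubgaussianMGF_of_mem_Icc (hmeas.comp_aemeasurable (hX i)) (ae_of_all _ fun ω => ?_)
    by_cases h : X i ω ∈ A <;> simp [h]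
  have hind' : iIndepFun (fun i ω => A.indicator (1 : ℝ → ℝ) (X i ω) - p) μ :=
    hind.comp (fun _ x => A.indicator (1 : ℝ → ℝ) x - p) fun _ => hmeas.sub_const p
  have key := HasSubgaussianMGF.measure_sum_ge_le_of_iIndepFun hind' hsub hδ
  have hset : {ω | δ ≤ ∑ i, (A.indicator (1 : ℝ → ℝ) (X i ω) - p)} =
      {ω | n * p + δ ≤ #{i | X i ω ∈ A}} := by
    ext ω
    have : ∑ i, A.indicator (1 : ℝ → ℝ) (X i ω) = #{i | X i ω ∈ A} := by
      simp [Set.indicator_apply]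
    simp only [Set.mem_ofPred_eq, sum_sub_distrib, this, sum_const, card_univ, Fintype.card_fin,
      nsmul_eq_mul]
    rw [le_sub_iff_add_le']
  rw [hset] at key
  refine key.trans_eq ?_
  congr 1
  rcases Nat.eq_zero_or_pos n with rfl | hn
  · simp
  · simp
    field_simp

theorem measureReal_forall_notMem_le [IsProbabilityMeasure μ] {ι : Type*} {X : ι → Ω → ℝ}
    (hX : ∀ i, pdf.IsUniform (X i) (Set.Icc 0 1) μ) (hind : iIndepFun X μ)
    {a b : ℝ} (ha : 0 ≤ a) (hab : a ≤ b) (hb : b ≤ 1) (s : Finset ι) :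
    μ.real {ω | ∀ i ∈ s, X i ω ∉ Set.Icc a b} ≤ Real.exp (-((b - a) * #s)) := by
  have hset : {ω | ∀ i ∈ s, X i ω ∉ Set.Icc a b} = ⋂ i ∈ s, X i ⁻¹' (Set.Icc a b)ᶜ := by
    ext ω; simp
  rw [hset, measureReal_def, hind.measure_inter_preimage_eq_mul s
    fun i _ => measurableSet_Icc.compl, ENNReal.toReal_prod]
  have hprob : ∀ i, (μ (X i ⁻¹' (Set.Icc a b)ᶜ)).toReal = 1 - (b - a) := fun i => by
    rw [← measureReal_def, Set.preimage_compl, measureReal_compl₀,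
      measureReal_preimage_of_isUniform (hX i) measurableSet_Icc,
      Set.inter_eq_right.2 (Set.Icc_subset_Icc ha hb)]
    · simp [hab]
    · exact (aemeasurable_of_isUniform (hX i)).nullMeasurable measurableSet_Icc
  simp_rw [hprob]
  rw [prod_const]
  calc (1 - (b - a)) ^ #s ≤ Real.exp (-(b - a)) ^ #s := by
        gcongr
        · linarith
        · linarith [Real.add_one_le_exp (-(b - a))]
    _ = Real.exp (-((b - a) * #s)) := by
        rw [← Real.exp_nat_mul]; congr 1; ring

end

/-! ### Probabilities of the exceptional events -/

section
variable {Ω : Type*} [MeasurableSpace Ω] {μ : Measure Ω} [IsProbabilityMeasure μ]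

theorem measureReal_exists_card_gt_ge_le {n : ℕ} (hn : 0 < n) (N : ℕ) {U : Fin n → Ω → ℝ}
    (hU : ∀ i, pdf.IsUniform (U i) (Set.Icc 0 1) μ) (hind : iIndepFun U μ) :
    μ.real {ω | ∃ k ≤ n, n + N ≤ #{i | (k / n : ℝ) < U i ω} + k} ≤
      (n + 1) * Real.exp (-(2 * (N : ℝ) ^ 2 / n)) := by
  have hn' : (0 : ℝ) < n := by exact_mod_cast hn
  have hset : {ω | ∃ k ≤ n, n + N ≤ #{i | (k / n : ℝ) < U i ω} + k} ⊆
      ⋃ k ∈ range (n + 1), {ω | n * (1 - k / n : ℝ) + N ≤ #{i | U i ω ∈ Set.Ioi (k / n : ℝ)}} := by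
    rintro ω ⟨k, hk, h⟩
    simp only [Set.mem_iUnion, mem_range, Set.mem_ofPred_eq, Set.mem_Ioi]
    refine ⟨k, by omega, ?_⟩
    have h' : (n + N : ℝ) ≤ #{i | (k / n : ℝ) < U i ω} + k := by exact_mod_cast h
    have : n * (1 - k / n : ℝ) = n - k := by field_simp
    linarith
  refine (measureReal_mono hset (measure_ne_top _ _)).trans ?_
  refine (measureReal_biUnion_finset_le _ _).trans ?_
  refine (sum_le_card_nsmul _ _ (Real.exp (-(2 * (N : ℝ) ^ 2 / n))) fun k hk => ?_).trans_eq
    (by simp)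
  have hk : (k : ℝ) ≤ n := by exact_mod_cast Nat.lt_succ_iff.1 (mem_range.1 hk)
  have hk1 : (k / n : ℝ) ≤ 1 := (div_le_one hn').2 hk
  refine measureReal_card_filter_mem_ge_le (fun i => aemeasurable_of_isUniform (hU i)) hind
    measurableSet_Ioi (fun i => ?_) N.cast_nonneg
  have : Set.Icc (0 : ℝ) 1 ∩ Set.Ioi (k / n : ℝ) = Set.Ioc (k / n : ℝ) 1 := by
    ext x
    simp only [Set.mem_inter_iff, Set.mem_Icc, Set.mem_Ioi, Set.mem_Ioc]
    exact ⟨fun h => ⟨h.2, h.1.2⟩, fun h => ⟨⟨le_trans (by positivity) h.1.le, h.2⟩, h.1⟩⟩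
  rw [measureReal_preimage_of_isUniform (hU i) measurableSet_Ioi, this]
  simp [hk1]

theorem measureReal_exists_card_lt_ge_le {n : ℕ} (hn : 0 < n) (N : ℕ) {V : Fin n → Ω → ℝ}
    (hV : ∀ i, pdf.IsUniform (V i) (Set.Icc 0 1) μ) (hind : iIndepFun V μ) :
    μ.real {ω | ∃ k ≤ n, k + N ≤ #{j | V j ω < (k / n : ℝ)}} ≤
      (n + 1) * Real.exp (-(2 * (N : ℝ) ^ 2 / n)) := by
  have hn' : (0 : ℝ) < n := by exact_mod_cast hn
  have hset : {ω | ∃ k ≤ n, k + N ≤ #{j | V j ω < (k / n : ℝ)}} ⊆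
      ⋃ k ∈ range (n + 1), {ω | n * (k / n : ℝ) + N ≤ #{i | V i ω ∈ Set.Iio (k / n : ℝ)}} := by
    rintro ω ⟨k, hk, h⟩
    simp only [Set.mem_iUnion, mem_range, Set.mem_ofPred_eq, Set.mem_Iio]
    refine ⟨k, by omega, ?_⟩
    rw [mul_div_cancel₀ _ hn'.ne']
    exact_mod_cast h
  refine (measureReal_mono hset (measure_ne_top _ _)).trans ?_
  refine (measureReal_biUnion_finset_le _ _).trans ?_
  refine (sum_le_card_nsmul _ _ (Real.exp (-(2 * (N : ℝ) ^ 2 / n))) fun k hk => ?_).trans_eq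
    (by simp)
  have hk : (k : ℝ) ≤ n := by exact_mod_cast Nat.lt_succ_iff.1 (mem_range.1 hk)
  have hk1 : (k / n : ℝ) ≤ 1 := (div_le_one hn').2 hk
  refine measureReal_card_filter_mem_ge_le (fun i => aemeasurable_of_isUniform (hV i)) hind
    measurableSet_Iio (fun i => ?_) N.cast_nonneg
  have : Set.Icc (0 : ℝ) 1 ∩ Set.Iio (k / n : ℝ) = Set.Ico 0 (k / n : ℝ) := by
    ext x
    simp only [Set.mem_inter_iff, Set.mem_Icc, Set.mem_Iio, Set.mem_Ico]
    exact ⟨fun h => ⟨h.1.1, h.2⟩, fun h => ⟨⟨h.1, h.2.le.trans hk1⟩, h.2⟩⟩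
  rw [measureReal_preimage_of_isUniform (hV i) measurableSet_Iio, this]
  simp [div_nonneg]

/-- It is unlikely that on some large rectangle `S × T` all the `W i j` avoid a grid interval of
length `N / n`. -/
theorem measureReal_exists_empty_rectangle_le {n : ℕ} (hn : 0 < n) (N : ℕ)
    {W : Fin n → Fin n → Ω → ℝ}
    (hW : ∀ i j, pdf.IsUniform (W i j) (Set.Icc 0 1) μ)
    (hind : iIndepFun (fun p : Fin n × Fin n => W p.1 p.2) μ) :
    μ.real {ω | ∃ k, k + N ≤ n ∧ ∃ S T : Finset (Fin n), N ≤ #S ∧ N ≤ #T ∧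
      ∀ i ∈ S, ∀ j ∈ T, W i j ω ∉ Set.Icc (k / n : ℝ) ((k + N : ℕ) / n : ℝ)} ≤
      (n + 1) * 4 ^ n * Real.exp (-((N : ℝ) ^ 3 / n)) := by
  have hn' : (0 : ℝ) < n := by exact_mod_cast hn
  set I : Finset (ℕ × Finset (Fin n) × Finset (Fin n)) :=
    {q ∈ range (n + 1) ×ˢ univ | q.1 + N ≤ n ∧ N ≤ #q.2.1 ∧ N ≤ #q.2.2} with hI
  have hIcard : (#I : ℝ) ≤ (n + 1) * 4 ^ n := by
    have : #I ≤ (n + 1) * 4 ^ n := by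
      refine (card_filter_le _ _).trans_eq ?_
      rw [card_product, card_range, card_univ, Fintype.card_prod, Fintype.card_finset,
        Fintype.card_fin, ← mul_pow]
      norm_num
    exact_mod_cast this
  have hset : {ω | ∃ k, k + N ≤ n ∧ ∃ S T : Finset (Fin n), N ≤ #S ∧ N ≤ #T ∧
      ∀ i ∈ S, ∀ j ∈ T, W i j ω ∉ Set.Icc (k / n : ℝ) ((k + N : ℕ) / n : ℝ)} ⊆
      ⋃ q ∈ I, {ω | ∀ p ∈ q.2.1 ×ˢ q.2.2,
        W p.1 p.2 ω ∉ Set.Icc (q.1 / n : ℝ) ((q.1 + N : ℕ) / n : ℝ)} := by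
    rintro ω ⟨k, hk, S, T, hS, hT, h⟩
    refine Set.mem_biUnion (x := (k, S, T)) ?_ ?_
    · simp only [hI, mem_coe, mem_filter, mem_product, mem_range, mem_univ, and_true]
      exact ⟨by omega, hk, hS, hT⟩
    · rintro ⟨i, j⟩ hp
      rw [mem_product] at hp
      exact h i hp.1 j hp.2
  refine (measureReal_mono hset (measure_ne_top _ _)).trans ?_
  refine (measureReal_biUnion_finset_le _ _).trans ?_
  refine (sum_le_card_nsmul _ _ (Real.exp (-((N : ℝ) ^ 3 / n))) fun q hq => ?_).trans ?_
  · simp only [hI, mem_filter] at hq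
    obtain ⟨-, hk, hS, hT⟩ := hq
    have hk' : ((q.1 + N : ℕ) : ℝ) ≤ n := by exact_mod_cast hk
    refine (measureReal_forall_notMem_le (a := q.1 / n) (b := (q.1 + N : ℕ) / n)
      (fun p => hW p.1 p.2) hind (by positivity)
      (div_le_div_of_nonneg_right (by exact_mod_cast Nat.le_add_right _ _) hn'.le)
      ((div_le_one hn').2 hk') (q.2.1 ×ˢ q.2.2)).trans ?_
    gcongr
    have hlen : ((q.1 + N : ℕ) / n - q.1 / n : ℝ) = N / n := by push_cast; ring
    have hcard : (N : ℝ) * N ≤ #(q.2.1 ×ˢ q.2.2) := by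
      rw [card_product]; exact_mod_cast Nat.mul_le_mul hS hT
    rw [hlen]
    calc (N : ℝ) ^ 3 / n = N / n * (N * N) := by ring
      _ ≤ _ := by gcongr
  · rw [nsmul_eq_mul]
    gcongr

/-- The union bound over the three exceptional events, for an arbitrary scale `N`. -/
theorem one_sub_le_measureReal_hasMatchingOfAllBut {n : ℕ} (hn : 0 < n) {N : ℕ} (hN : 0 < N)
    {U V : Fin n → Ω → ℝ} {W : Fin n → Fin n → Ω → ℝ}
    (hU : ∀ i, pdf.IsUniform (U i) (Set.Icc 0 1) μ)
    (hV : ∀ j, pdf.IsUniform (V j) (Set.Icc 0 1) μ)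
    (hW : ∀ i j, pdf.IsUniform (W i j) (Set.Icc 0 1) μ)
    (hind : iIndepFun (Sum.elim U (Sum.elim V fun p : Fin n × Fin n => W p.1 p.2)) μ) :
    1 - (2 * ((n + 1) * Real.exp (-(8 * (N : ℝ) ^ 2 / n))) +
        (n + 1) * 4 ^ n * Real.exp (-(8 * (N : ℝ) ^ 3 / n))) ≤
      μ.real {ω | HasMatchingOfAllBut
        (labelGraph (fun i => U i ω) (fun j => V j ω) (fun i j => W i j ω)) (22 * N)} := by
  have hindU : iIndepFun U μ := hind.precomp (g := Sum.inl) Sum.inl_injective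
  have hindV : iIndepFun V μ := hind.precomp (g := Sum.inr ∘ Sum.inl)
    (Sum.inr_injective.comp Sum.inl_injective)
  have hindW : iIndepFun (fun p : Fin n × Fin n => W p.1 p.2) μ :=
    hind.precomp (g := Sum.inr ∘ Sum.inr) (Sum.inr_injective.comp Sum.inr_injective)
  have h1 := measureReal_exists_card_gt_ge_le hn (2 * N) hU hindU
  have h2 := measureReal_exists_card_lt_ge_le hn (2 * N) hV hindV
  have h3 := measureReal_exists_empty_rectangle_le hn (2 * N) hW hindW
  set B1 := {ω | ∃ k ≤ n, n + 2 * N ≤ #{i | (k / n : ℝ) < U i ω} + k}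
  set B2 := {ω | ∃ k ≤ n, k + 2 * N ≤ #{j | V j ω < (k / n : ℝ)}}
  set B3 := {ω | ∃ k, k + 2 * N ≤ n ∧ ∃ S T : Finset (Fin n), 2 * N ≤ #S ∧ 2 * N ≤ #T ∧
      ∀ i ∈ S, ∀ j ∈ T, W i j ω ∉ Set.Icc (k / n : ℝ) ((k + 2 * N : ℕ) / n : ℝ)}
  set G := {ω | HasMatchingOfAllBut
        (labelGraph (fun i => U i ω) (fun j => V j ω) (fun i j => W i j ω)) (22 * N)}
  -- A cover of the whole space is used because `G` need not be measurable.
  have hcover : Set.univ ⊆ G ∪ (B1 ∪ B2 ∪ B3) := by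
    intro ω _
    by_contra hω
    simp only [Set.mem_union, not_or] at hω
    obtain ⟨hG, ⟨hB1, hB2⟩, hB3⟩ := hω
    refine hG ?_
    have hM := hasMatchingOfAllBut_labelGraph (fun i => U i ω) (fun j => V j ω)
      (fun i j => W i j ω) (11 * N) (exists_edge_of_evenly_spread N hN _ _ _ ?_ ?_ ?_)
    · have : (2 * ((11 * N : ℕ) : ℝ)) = 22 * N := by push_cast; ring
      rwa [this] at hM
    · intro k hk
      by_contra! h
      exact hB1 ⟨k, hk, h⟩
    · intro k hk
      by_contra! h
      exact hB2 ⟨k, hk, h⟩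
    · intro k hk S T hS hT
      by_contra! h
      exact hB3 ⟨k, hk, S, T, hS, hT, h⟩
  have hle : 1 ≤ μ.real G + (μ.real B1 + μ.real B2 + μ.real B3) := by
    calc (1 : ℝ) = μ.real Set.univ := by simp
      _ ≤ μ.real (G ∪ (B1 ∪ B2 ∪ B3)) := measureReal_mono hcover (measure_ne_top _ _)
      _ ≤ μ.real G + μ.real (B1 ∪ B2 ∪ B3) := measureReal_union_le _ _
      _ ≤ _ := by
        gcongr
        refine (measureReal_union_le _ _).trans ?_
        gcongr
        exact measureReal_union_le _ _
  have e2 : 2 * ((2 * N : ℕ) : ℝ) ^ 2 / n = 8 * (N : ℝ) ^ 2 / n := by push_cast; ring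
  have e3 : ((2 * N : ℕ) : ℝ) ^ 3 / n = 8 * (N : ℝ) ^ 3 / n := by push_cast; ring
  rw [e2] at h1 h2
  rw [e3] at h3
  linarith

end

/-! ### Numerical estimates -/

theorem add_one_le_exp_three_mul_rpow {x s : ℝ} (hx : 1 ≤ x) (hs : 1 / 3 ≤ s) :
    x + 1 ≤ Real.exp (3 * x ^ s) := by
  have hx0 : 0 ≤ x := by linarith
  have hcube : x ≤ (x ^ s) ^ 3 := by
    rw [← Real.rpow_natCast, ← Real.rpow_mul hx0]
    exact Real.self_le_rpow_of_one_le hx (by push_cast; linarith)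
  have ht : 0 ≤ x ^ s := by positivity
  calc x + 1 ≤ (x ^ s + 1) ^ 3 := by nlinarith
    _ ≤ Real.exp (x ^ s) ^ 3 := by gcongr; exact Real.add_one_le_exp _
    _ = _ := by rw [← Real.exp_nat_mul]; norm_num

theorem add_one_mul_exp_sq_le {x y γ : ℝ} (hx : 1 ≤ x) (hγ : 2 / 3 ≤ γ) (hy : x ^ γ ≤ y) :
    (x + 1) * Real.exp (-(8 * y ^ 2 / x)) ≤ Real.exp (-2 * x ^ (2 * γ - 1)) := by
  have hx0 : 0 < x := by linarith
  have ht : 0 ≤ x ^ (2 * γ - 1) := by positivity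
  have hsq : x ^ (2 * γ - 1) ≤ y ^ 2 / x := by
    rw [Real.rpow_sub hx0, Real.rpow_one, two_mul, Real.rpow_add hx0, ← sq]
    gcongr
  calc (x + 1) * Real.exp (-(8 * y ^ 2 / x))
      ≤ Real.exp (3 * x ^ (2 * γ - 1)) * Real.exp (-(8 * y ^ 2 / x)) := by
        gcongr; exact add_one_le_exp_three_mul_rpow hx (by linarith)
    _ ≤ _ := by
        rw [← Real.exp_add]; gcongr
        rw [mul_div_assoc]; linarith

theorem add_one_mul_four_pow_mul_exp_cube_le {n : ℕ} {y γ : ℝ} (hn : 0 < n) (hγ : 2 / 3 ≤ γ)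
    (hy : (n : ℝ) ^ γ ≤ y) :
    (n + 1) * 4 ^ n * Real.exp (-(8 * y ^ 3 / n)) ≤ Real.exp (-2 * (n : ℝ) ^ (2 * γ - 1)) := by
  have hn1 : (1 : ℝ) ≤ n := by exact_mod_cast hn
  have hx0 : (0 : ℝ) < n := by linarith
  have hcube : (n : ℝ) ^ (3 * γ - 1) ≤ y ^ 3 / n := by
    rw [Real.rpow_sub hx0, Real.rpow_one, mul_comm 3 γ, Real.rpow_mul hx0.le,
      show (3 : ℝ) = (3 : ℕ) by norm_num, Real.rpow_natCast]
    gcongr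
  have h1 : (n : ℝ) ≤ (n : ℝ) ^ (3 * γ - 1) := Real.self_le_rpow_of_one_le hn1 (by linarith)
  have h2 : (n : ℝ) ^ (2 * γ - 1) ≤ (n : ℝ) ^ (3 * γ - 1) :=
    Real.rpow_le_rpow_of_exponent_le hn1 (by linarith)
  have h4 : (4 : ℝ) ≤ Real.exp 2 := by
    have h := Real.add_one_le_exp (1 : ℝ)
    calc (4 : ℝ) ≤ Real.exp 1 * Real.exp 1 := by nlinarith
      _ = Real.exp 2 := by rw [← Real.exp_add]; norm_num
  calc (n + 1) * 4 ^ n * Real.exp (-(8 * y ^ 3 / n))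
      ≤ Real.exp n * Real.exp 2 ^ n * Real.exp (-(8 * y ^ 3 / n)) := by
        gcongr; exact Real.add_one_le_exp _
    _ ≤ _ := by
        rw [← Real.exp_nat_mul, ← Real.exp_add, ← Real.exp_add]
        gcongr
        rw [mul_div_assoc]; linarith

end

open MeasureTheory ProbabilityTheory in
theorem lemma4p2 :
    ∃ C : ℝ, 0 < C ∧ ∀ (γ : ℝ), 2 / 3 ≤ γ → ∀ (n : ℕ)
      (Ω : Type*) [MeasurableSpace Ω] (μ : Measure Ω) [IsProbabilityMeasure μ]
      (U V : Fin n → Ω → ℝ) (W : Fin n → Fin n → Ω → ℝ),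
      (∀ i, pdf.IsUniform (U i) (Set.Icc 0 1) μ) →
      (∀ j, pdf.IsUniform (V j) (Set.Icc 0 1) μ) →
      (∀ i j, pdf.IsUniform (W i j) (Set.Icc 0 1) μ) →
      -- all the labels and all the `W i j` are jointly independent
      iIndepFun (Sum.elim U (Sum.elim V fun p : Fin n × Fin n => W p.1 p.2)) μ →
      1 - 5 * Real.exp (-2 * (n : ℝ) ^ (2 * γ - 1)) ≤
        μ.real {ω | HasMatchingOfAllBut
          (labelGraph (fun i => U i ω) (fun j => V j ω) (fun i j => W i j ω))
          (C * (n : ℝ) ^ γ)} := by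
  refine ⟨44, by norm_num, fun γ hγ n Ω _ μ _ U V W hU hV hW hind => ?_⟩
  rcases Nat.eq_zero_or_pos n with rfl | hn
  · have hzero : ((0 : ℕ) : ℝ) ^ (2 * γ - 1) = 0 := by
      rw [Nat.cast_zero, Real.zero_rpow (by linarith)]
    -- The bound is `1 - 5 exp 0 < 0`.
    rw [hzero, mul_zero, Real.exp_zero]
    exact le_trans (by norm_num) measureReal_nonneg
  have hn1 : (1 : ℝ) ≤ n := by exact_mod_cast hn
  have hpow : 1 ≤ (n : ℝ) ^ γ := Real.one_le_rpow hn1 (by linarith)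
  have hle : (n : ℝ) ^ γ ≤ ⌈(n : ℝ) ^ γ⌉₊ := Nat.le_ceil _
  have hlt : (⌈(n : ℝ) ^ γ⌉₊ : ℝ) < (n : ℝ) ^ γ + 1 := Nat.ceil_lt_add_one (by linarith)
  have hmain := one_sub_le_measureReal_hasMatchingOfAllBut hn (N := ⌈(n : ℝ) ^ γ⌉₊)
    (Nat.ceil_pos.2 (by linarith)) hU hV hW hind
  have h1 := add_one_mul_exp_sq_le hn1 hγ hle
  have h2 := add_one_mul_four_pow_mul_exp_cube_le hn hγ hle
  have hexp := Real.exp_pos (-2 * (n : ℝ) ^ (2 * γ - 1))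
  refine le_trans (by linarith) (hmain.trans ?_)
  refine measureReal_mono (fun ω hω => ?_) (measure_ne_top _ _)
  exact HasMatchingOfAllBut.mono hω (by linarith)
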